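/- Consider one base station of a wireless network with integer $M\ge 1$ mini-slots per slot, arrival probability $p\in[0,1]$, jamming probability $q\in(0,1)$, per-mini-slot departure probabilities $0\le r<r'\le 1$ (channel jammed, respectively not jammed), holding cost $C>0$ and tax $\lambda\in\mathbb R$. Put $$b_d=\binom Md\bigl[r^d(1-r)^{M-d}q+r'^d(1-r')^{M-d}(1-q)\bigr],\qquad 0\le d\le M.$$ If $x$ users are associated with the station at the start of a slot, the number $D$ of departures has law $P_d(x)=b_d$ for $0\le d<\min(x,M)$ and $P_d(x)=\sum_{e=d}^{M}b_e$ for $d=\min(x,M)$. With action $u\in\{0,1\}$ ($u=1$: accept an arriving user) the next state is $x-D+\varsigma u$, where $\varsigma$ is Bernoulli($p$) and independent of $D$, and the cost of the slot is $Cx+(1-u)\lambda$. For $\alpha\in(0,1)$ let $$V^\alpha(x)=\inf_\pi \mathbb E_\pi\Bigl[\sum_{n\ge0}\alpha^n\bigl(CX_n+(1-u_n)\lambda\bigr)\Big|X_0=x\Bigr],$$ the infimum being over stationary policies $\pi:\{0,1,2,\dots\}\to\{0,1\}$, $u_n=\pi(X_n)$. The relative value function $V:\{0,1,2,\ldots\}\to\mathbb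 R$ and the constant $\eta$ are the pair with $V(0)=0$ that satisfies, for all $x\ge 0$, the dynamic programming equation $$V(x)=Cx-\eta+\min\bigl\{\mathbb E\,V(x-D+\varsigma)\,;\ \lambda+\mathbb E\,V(x-D)\bigr\}$$ and is given by $V(x)=\lim_{\alpha\uparrow1}\bigl(V^\alpha(x)-V^\alpha(0)\bigr)$ and $\eta=\lim_{\alpha\uparrow1}(1-\alpha)V^\alpha(0)$. Then such a pair $(V,\eta)$ exists, and the relative value function is (strictly) increasing in the number of associated users: $V(x_1)>V(x_2)$ for all integers $x_1>x_2\ge0$. -/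

import Mathlib

open Filter Topology

noncomputable section

namespace AssocMDP

/-- The data of the decoupled control problem of one base station: number `M` of mini-slots per
slot, arrival probability `p`, jamming probability `q`, departure probability per mini-slot `rJam`
(channel jammed) and `rClear` (channel not jammed), holding cost `C` per user and slot, and tax
`lam` for rejecting. -/
structure Station where
  M : ℕ
  p : ℝ
  q : ℝ
  rJam : ℝ
  rClear : ℝ
  C : ℝ
  lam : ℝ

/-- `binom(M,d) [ r^d (1-r)^(M-d) q + r'^d (1-r')^(M-d) (1-q) ]`. -/
def binomMix (S : Station) (d : ℕ) : ℝ :=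
  (S.M.choose d : ℝ) *
    (S.rJam ^ d * (1 - S.rJam) ^ (S.M - d) * S.q
      + S.rClear ^ d * (1 - S.rClear) ^ (S.M - d) * (1 - S.q))

/-- `P_d(x)`: probability that exactly `d` users depart in a slot that starts with `x` users.
For `x = 0` it is the point mass at `d = 0`. -/
def depProb (S : Station) (x d : ℕ) : ℝ :=
  if d < min x S.M then binomMix S d
  else if d = min x S.M then ∑ e ∈ Finset.Icc (min x S.M) S.M, binomMix S e
  else 0

/-- Law of the arrival indicator `ς` (`true`: a user arrives). -/
def arrProb (S : Station) (s : Bool) : ℝ := if s then S.p else 1 - S.p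

/-- One-slot cost `C x + (1 - u) λ`; action `true` is "accept", `false` is "reject". -/
def cost (S : Station) (x : ℕ) (u : Bool) : ℝ :=
  S.C * (x : ℝ) + (1 - (u.toNat : ℝ)) * S.lam

/-- `E[ f(X_{n+1}) | X_n = x, u_n = u ]`, where `X_{n+1} = X_n - D_n + ς_{n+1} u_n` with `D_n` and
`ς_{n+1}` independent. -/
def stepExp (S : Station) (u : Bool) (f : ℕ → ℝ) (x : ℕ) : ℝ :=
  ∑ s : Bool, arrProb S s *
    ∑ d ∈ Finset.range (min x S.M + 1), depProb S x d * f (x - d + u.toNat * s.toNat)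

/-- `E[ f(X_n) | X_0 = x ]` for the Markov chain induced by the stationary policy `π`
(`u_n = π (X_n)`). -/
def stateExp (S : Station) (π : ℕ → Bool) : ℕ → (ℕ → ℝ) → ℕ → ℝ
  | 0, f, x => f x
  | n + 1, f, x => stepExp S (π x) (stateExp S π n f) x

/-- Infinite-horizon expected `α`-discounted cost of the stationary policy `π` from state `x`. -/
def discCost (S : Station) (α : ℝ) (π : ℕ → Bool) (x : ℕ) : ℝ :=
  ∑' n : ℕ, α ^ n * stateExp S π n (fun y => cost S y (π y)) x

/-- `V^α(x)`: optimal `α`-discounted cost over all stationary policies. -/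
def discValue (S : Station) (α : ℝ) (x : ℕ) : ℝ :=
  ⨅ π : ℕ → Bool, discCost S α π x

/-- The average-cost dynamic programming equation for the pair `(V, η)`. In each minimum the first
entry is the action "accept", the second "reject". -/
def SolvesDPE (S : Station) (V : ℕ → ℝ) (η : ℝ) : Prop :=
  ∀ x : ℕ, V x = S.C * (x : ℝ) - η + min
    (∑ d ∈ Finset.range (min S.M x), V (x - d + 1) * (S.p * binomMix S d)
      + ∑ d ∈ Finset.range (min S.M x), V (x - d) * ((1 - S.p) * binomMix S d)
      + V (x - S.M + 1) * ∑ d ∈ Finset.Icc (min S.M x) S.M, S.p * binomMix S d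
      + V (x - S.M) * ∑ d ∈ Finset.Icc (min S.M x) S.M, (1 - S.p) * binomMix S d)
    (S.lam + ∑ d ∈ Finset.range (min S.M x), V (x - d) * binomMix S d
      + V (x - S.M) * ∑ d ∈ Finset.Icc (min S.M x) S.M, binomMix S d)

/-- `V` is the relative value function and `η` the constant of the average-cost dynamic
programming equation: the pair solves the equation, `V` is normalised at `0`, and `(V, η)` is the
vanishing-discount limit of `(V^α - V^α(0), (1 - α) V^α(0))`. -/
structure IsRelativeValueFunction (S : Station) (V : ℕ → ℝ) (η : ℝ) : Prop where
  dpe : SolvesDPE S V η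
  zero : V 0 = 0
  tendsto_value : ∀ x : ℕ,
    Tendsto (fun α : ℝ => discValue S α x - discValue S α 0) (𝓝[<] 1) (𝓝 (V x))
  tendsto_const : Tendsto (fun α : ℝ => (1 - α) * discValue S α 0) (𝓝[<] 1) (𝓝 η)

end AssocMDP

end

/-! With departures capped at the population, the next state before arrivals is `x - e` with
truncated subtraction and `e` drawn from a law independent of `x`, so expectations preserve
monotonicity. Value iteration from a constant therefore gives a monotone solution of the discounted
optimality equation, and a verification argument identifies it with `discValue`. The holding cost
alone then forces V^α(x+1) - V^α(x) ≥ C. This gap does not depend on α, so it survives α → 1 and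
gives strict monotonicity.

Existence of the limits is the harder half. By `discValue_succ_ge` the increments have a lower bound
growing with x, so for p > 0 rejecting is optimal beyond a threshold uniform in α near 1; for p = 0
the sign of λ decides. Hence finitely many policies suffice. Each has a discounted cost rational in
α by Cramer's rule, and a meromorphic function does not oscillate in sign, so at each state one
policy is optimal for all α < 1 near 1. Thus V^α(x) agrees, left of 1, with a function meromorphic
at 1. Since V^α(x) - V^α(0) and (1-α)V^α(0) are bounded, they have no pole and converge, and the
optimality equation passes to the limit. -/

namespace AssocMDP

/-- The standing assumptions on the parameters of a station. -/
structure Station.Valid (S : Station) : Prop where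
  p_nonneg : 0 ≤ S.p
  p_le_one : S.p ≤ 1
  q_pos : 0 < S.q
  q_lt_one : S.q < 1
  rJam_nonneg : 0 ≤ S.rJam
  rJam_lt_rClear : S.rJam < S.rClear
  rClear_le_one : S.rClear ≤ 1
  C_pos : 0 < S.C
  M_pos : 1 ≤ S.M

variable {S : Station}

/-! ### Law of the departures -/

section Departures

theorem binomMix_nonneg (hS : S.Valid) (d : ℕ) : 0 ≤ binomMix S d := by
  obtain ⟨_, _, hq, hq', hr, hrr, hr', _, _⟩ := hS
  have h1 : 0 ≤ 1 - S.rJam := by linarith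
  have h2 : 0 ≤ 1 - S.rClear := by linarith
  have h3 : 0 ≤ S.rClear := by linarith
  have h4 : 0 ≤ 1 - S.q := by linarith
  unfold binomMix
  positivity

theorem sum_binomMix (S : Station) : ∑ d ∈ Finset.range (S.M + 1), binomMix S d = 1 := by
  have key : ∀ r : ℝ, ∑ d ∈ Finset.range (S.M + 1),
      r ^ d * (1 - r) ^ (S.M - d) * (S.M.choose d : ℝ) = 1 := fun r => by
    rw [← add_pow]; simp
  calc ∑ d ∈ Finset.range (S.M + 1), binomMix S d
      = S.q * ∑ d ∈ Finset.range (S.M + 1),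
          S.rJam ^ d * (1 - S.rJam) ^ (S.M - d) * (S.M.choose d : ℝ)
        + (1 - S.q) * ∑ d ∈ Finset.range (S.M + 1),
          S.rClear ^ d * (1 - S.rClear) ^ (S.M - d) * (S.M.choose d : ℝ) := by
        rw [Finset.mul_sum, Finset.mul_sum, ← Finset.sum_add_distrib]
        exact Finset.sum_congr rfl fun d _ => by unfold binomMix; ring
    _ = 1 := by rw [key, key]; ring

/-- The clear channel has positive probability 1 - q and departure rate r' > r ≥ 0, so a departure
has positive probability. This drives the bound on relative values. -/
theorem binomMix_zero_lt_one (hS : S.Valid) : binomMix S 0 < 1 := by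
  obtain ⟨_, _, hq, hq', hr, hrr, hr', _, hM⟩ := hS
  have h1 : (1 - S.rJam) ^ S.M ≤ 1 := pow_le_one₀ (by linarith) (by linarith)
  have h2 : (1 - S.rClear) ^ S.M < 1 := pow_lt_one₀ (by linarith) (by linarith) (by omega)
  simp only [binomMix, Nat.choose_zero_right, Nat.cast_one, pow_zero, one_mul, Nat.sub_zero]
  nlinarith

/-- The mass lumped at `min x M` is spread back over the larger `e`: truncated subtraction sends all
of them to the same state. -/
theorem sum_depProb_mul (S : Station) (x : ℕ) (g : ℕ → ℝ) :
    ∑ d ∈ Finset.range (min x S.M + 1), depProb S x d * g (x - d)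
      = ∑ e ∈ Finset.range (S.M + 1), binomMix S e * g (x - e) := by
  have hsplit := Finset.sum_range_add_sum_Ico (fun e => binomMix S e * g (x - e))
    (show min x S.M ≤ S.M + 1 by omega)
  rw [Finset.sum_range_succ, ← hsplit]
  congr 1
  · refine Finset.sum_congr rfl fun d hd => ?_
    rw [depProb, if_pos (Finset.mem_range.1 hd)]
  · rw [depProb, if_neg (lt_irrefl _), if_pos rfl, Finset.sum_mul]
    refine Finset.sum_congr ?_ fun e he => ?_
    · ext e; simp only [Finset.mem_Icc, Finset.mem_Ico]; omega
    · have := Finset.mem_Icc.1 he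
      rw [show x - min x S.M = x - e by omega]

end Departures

/-! ### One-step expectations -/

section StepExp

theorem stepExp_eq (S : Station) (u : Bool) (f : ℕ → ℝ) (x : ℕ) :
    stepExp S u f x = ∑ e ∈ Finset.range (S.M + 1), binomMix S e *
      (S.p * f (x - e + u.toNat) + (1 - S.p) * f (x - e)) := by
  have h1 := sum_depProb_mul S x fun y => f (y + u.toNat)
  have h2 := sum_depProb_mul S x f
  simp only [stepExp, Fintype.sum_bool, arrProb, Bool.toNat_true, Bool.toNat_false, mul_one,
    mul_zero, add_zero, if_true, Bool.false_eq_true, if_false]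
  rw [h1, h2, Finset.mul_sum, Finset.mul_sum, ← Finset.sum_add_distrib]
  exact Finset.sum_congr rfl fun e _ => by ring

theorem stepExp_mono (hS : S.Valid) (u : Bool) {f g : ℕ → ℝ} (x : ℕ)
    (h : ∀ y, f y ≤ g y) : stepExp S u f x ≤ stepExp S u g x := by
  have h0 := hS.p_nonneg
  have h1 : 0 ≤ 1 - S.p := by linarith [hS.p_le_one]
  rw [stepExp_eq, stepExp_eq]
  refine Finset.sum_le_sum fun e _ => mul_le_mul_of_nonneg_left ?_ (binomMix_nonneg hS e)
  exact add_le_add (mul_le_mul_of_nonneg_left (h _) h0) (mul_le_mul_of_nonneg_left (h _) h1)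

theorem stepExp_add (S : Station) (u : Bool) (f g : ℕ → ℝ) (x : ℕ) :
    stepExp S u (fun y => f y + g y) x = stepExp S u f x + stepExp S u g x := by
  simp only [stepExp_eq, ← Finset.sum_add_distrib]
  exact Finset.sum_congr rfl fun e _ => by ring

theorem stepExp_const_mul (S : Station) (u : Bool) (c : ℝ) (f : ℕ → ℝ) (x : ℕ) :
    stepExp S u (fun y => c * f y) x = c * stepExp S u f x := by
  simp only [stepExp_eq, Finset.mul_sum]
  exact Finset.sum_congr rfl fun e _ => by ring

theorem stepExp_sum {ι : Type*} (S : Station) (u : Bool) (s : Finset ι) (f : ι → ℕ → ℝ) (x : ℕ) :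
    stepExp S u (fun y => ∑ i ∈ s, f i y) x = ∑ i ∈ s, stepExp S u (f i) x := by
  simp only [stepExp_eq, Finset.mul_sum, ← Finset.sum_add_distrib]
  exact Finset.sum_comm

theorem stepExp_const (S : Station) (u : Bool) (c : ℝ) (x : ℕ) :
    stepExp S u (fun _ => c) x = c := by
  have h : ∀ e, binomMix S e * (S.p * c + (1 - S.p) * c) = binomMix S e * c := fun e => by ring
  simp only [stepExp_eq, h]
  rw [← Finset.sum_mul, sum_binomMix, one_mul]

theorem stepExp_sub_const (S : Station) (u : Bool) (f : ℕ → ℝ) (c : ℝ) (x : ℕ) :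
    stepExp S u (fun y => f y - c) x = stepExp S u f x - c := by
  have := stepExp_add S u f (fun _ => -c) x
  rw [stepExp_const] at this
  simpa [sub_eq_add_neg] using this

theorem stepExp_of_p_eq_zero (hp : S.p = 0) (u v : Bool) (f : ℕ → ℝ) (x : ℕ) :
    stepExp S u f x = stepExp S v f x := by
  simp [stepExp_eq, hp]

theorem monotone_stepExp (hS : S.Valid) (u : Bool) {f : ℕ → ℝ} (hf : Monotone f) :
    Monotone (stepExp S u f) := by
  intro x y hxy
  have h0 := hS.p_nonneg
  have h1 : 0 ≤ 1 - S.p := by linarith [hS.p_le_one]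
  rw [stepExp_eq, stepExp_eq]
  refine Finset.sum_le_sum fun e _ => mul_le_mul_of_nonneg_left ?_ (binomMix_nonneg hS e)
  exact add_le_add (mul_le_mul_of_nonneg_left (hf (by omega)) h0)
    (mul_le_mul_of_nonneg_left (hf (by omega)) h1)

/-- Increments of `f` are inherited by its conditional expectations. -/
theorem stepExp_succ_ge (hS : S.Valid) (u : Bool) {f : ℕ → ℝ} {δ : ℝ} {x : ℕ} (hx : S.M ≤ x)
    (hf : ∀ y, x ≤ y + S.M → f y + δ ≤ f (y + 1)) :
    stepExp S u f x + δ ≤ stepExp S u f (x + 1) := by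
  have h0 := hS.p_nonneg
  have h1 : 0 ≤ 1 - S.p := by linarith [hS.p_le_one]
  rw [← stepExp_const S u δ x, ← stepExp_add, stepExp_eq, stepExp_eq]
  refine Finset.sum_le_sum fun e he => mul_le_mul_of_nonneg_left ?_ (binomMix_nonneg hS e)
  have he' : e ≤ S.M := Nat.lt_succ_iff.1 (Finset.mem_range.1 he)
  rw [show x + 1 - e + u.toNat = (x - e + u.toNat) + 1 by omega,
    show x + 1 - e = (x - e) + 1 by omega]
  exact add_le_add (mul_le_mul_of_nonneg_left (hf _ (by omega)) h0)
    (mul_le_mul_of_nonneg_left (hf _ (by omega)) h1)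

/-- Accepting rather than rejecting raises the expected value of a function with large
increments. -/
theorem stepExp_true_ge (hS : S.Valid) {f : ℕ → ℝ} {δ : ℝ} {x : ℕ}
    (hf : ∀ y, x ≤ y + S.M → f y + δ ≤ f (y + 1)) :
    stepExp S false f x + S.p * δ ≤ stepExp S true f x := by
  rw [← stepExp_const S false (S.p * δ) x, ← stepExp_add, stepExp_eq, stepExp_eq]
  refine Finset.sum_le_sum fun e he => mul_le_mul_of_nonneg_left ?_ (binomMix_nonneg hS e)
  have he' : e ≤ S.M := Nat.lt_succ_iff.1 (Finset.mem_range.1 he)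
  have := mul_le_mul_of_nonneg_left (hf (x - e) (by omega)) hS.p_nonneg
  simp only [Bool.toNat_true, Bool.toNat_false, add_zero]
  linarith

theorem stepExp_cast_le (hS : S.Valid) (u : Bool) (x : ℕ) :
    stepExp S u (fun y => (y : ℝ)) x ≤ x + 1 := by
  rw [← stepExp_const S u ((x : ℝ) + 1) x, stepExp_eq, stepExp_eq]
  refine Finset.sum_le_sum fun e _ => mul_le_mul_of_nonneg_left ?_ (binomMix_nonneg hS e)
  have hu : u.toNat ≤ 1 := Bool.toNat_le u
  have ha : ((x - e + u.toNat : ℕ) : ℝ) ≤ x + 1 := by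
    exact_mod_cast (show x - e + u.toNat ≤ x + 1 by omega)
  have hb : ((x - e : ℕ) : ℝ) ≤ x + 1 := by
    exact_mod_cast (show x - e ≤ x + 1 by omega)
  exact add_le_add (mul_le_mul_of_nonneg_left ha hS.p_nonneg)
    (mul_le_mul_of_nonneg_left hb (by linarith [hS.p_le_one]))

theorem stepExp_false_cast_le (hS : S.Valid) (x : ℕ) :
    stepExp S false (fun y => (y : ℝ)) x ≤ x := by
  rw [← stepExp_const S false (x : ℝ) x, stepExp_eq, stepExp_eq]
  refine Finset.sum_le_sum fun e _ => mul_le_mul_of_nonneg_left ?_ (binomMix_nonneg hS e)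
  have hb : ((x - e : ℕ) : ℝ) ≤ x := by exact_mod_cast Nat.sub_le x e
  simp only [Bool.toNat_false, add_zero]
  linarith

theorem tendsto_stepExp {ι : Type*} {l : Filter ι} (S : Station) (u : Bool) {f : ι → ℕ → ℝ}
    {g : ℕ → ℝ} (h : ∀ y, Tendsto (fun i => f i y) l (𝓝 (g y))) (x : ℕ) :
    Tendsto (fun i => stepExp S u (f i) x) l (𝓝 (stepExp S u g x)) := by
  simp only [stepExp_eq]
  exact tendsto_finsetSum _ fun e _ =>
    (((h _).const_mul _).add ((h _).const_mul _)).const_mul _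

end StepExp

/-! ### Bellman operator and value iteration -/

section Bellman

/-- Cost of taking action `u` in state `x` when the value of the next state is `f`. -/
def actionValue (S : Station) (α : ℝ) (f : ℕ → ℝ) (u : Bool) (x : ℕ) : ℝ :=
  cost S x u + α * stepExp S u f x

/-- The Bellman operator of the discounted problem. -/
def bellman (S : Station) (α : ℝ) (f : ℕ → ℝ) (x : ℕ) : ℝ :=
  min (actionValue S α f true x) (actionValue S α f false x)

theorem cost_true (S : Station) (x : ℕ) : cost S x true = S.C * x := by simp [cost]

theorem cost_false (S : Station) (x : ℕ) : cost S x false = S.C * x + S.lam := by simp [cost]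

theorem min_zero_lam_le_cost (hS : S.Valid) (x : ℕ) (u : Bool) : min 0 S.lam ≤ cost S x u := by
  have h : 0 ≤ S.C * (x : ℝ) := mul_nonneg hS.C_pos.le x.cast_nonneg
  cases u
  · rw [cost_false]; linarith [min_le_right 0 S.lam]
  · rw [cost_true]; linarith [min_le_left 0 S.lam]

theorem abs_cost_le (hS : S.Valid) (x : ℕ) (u : Bool) : |cost S x u| ≤ S.C * x + |S.lam| := by
  have h : 0 ≤ S.C * (x : ℝ) := mul_nonneg hS.C_pos.le x.cast_nonneg
  cases u
  · rw [cost_false]; exact (abs_add_le _ _).trans (by rw [abs_of_nonneg h])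
  · rw [cost_true, abs_of_nonneg h]; linarith [abs_nonneg S.lam]

theorem bellman_le (S : Station) (α : ℝ) (f : ℕ → ℝ) (u : Bool) (x : ℕ) :
    bellman S α f x ≤ actionValue S α f u x := by
  cases u
  · exact min_le_right _ _
  · exact min_le_left _ _

theorem le_bellman {α : ℝ} {f : ℕ → ℝ} {x : ℕ} {a : ℝ}
    (h : ∀ u, a ≤ actionValue S α f u x) : a ≤ bellman S α f x :=
  le_min (h true) (h false)

theorem exists_bellman_eq (S : Station) (α : ℝ) (f : ℕ → ℝ) (x : ℕ) :
    ∃ u, bellman S α f x = actionValue S α f u x := by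
  rcases min_choice (actionValue S α f true x) (actionValue S α f false x) with h | h
  · exact ⟨true, h⟩
  · exact ⟨false, h⟩

theorem actionValue_mono (hS : S.Valid) {α : ℝ} (hα : 0 ≤ α) {f g : ℕ → ℝ}
    (h : ∀ y, f y ≤ g y) (u : Bool) (x : ℕ) :
    actionValue S α f u x ≤ actionValue S α g u x := by
  unfold actionValue
  linarith [mul_le_mul_of_nonneg_left (stepExp_mono hS u x h) hα]

theorem bellman_mono (hS : S.Valid) {α : ℝ} (hα : 0 ≤ α) {f g : ℕ → ℝ}
    (h : ∀ y, f y ≤ g y) (x : ℕ) : bellman S α f x ≤ bellman S α g x :=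
  le_bellman fun u => (bellman_le S α f u x).trans (actionValue_mono hS hα h u x)

theorem monotone_bellman (hS : S.Valid) {α : ℝ} (hα : 0 ≤ α) {f : ℕ → ℝ} (hf : Monotone f) :
    Monotone (bellman S α f) := by
  intro x y hxy
  refine le_bellman fun u => (bellman_le S α f u x).trans ?_
  have h1 := mul_le_mul_of_nonneg_left (monotone_stepExp hS u hf hxy) hα
  have h2 : S.C * (x : ℝ) ≤ S.C * y :=
    mul_le_mul_of_nonneg_left (by exact_mod_cast hxy) hS.C_pos.le
  simp only [actionValue, cost]
  linarith

theorem tendsto_bellman {ι : Type*} {l : Filter ι} (S : Station) {α : ι → ℝ} {a : ℝ}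
    (hα : Tendsto α l (𝓝 a)) {f : ι → ℕ → ℝ}
    {g : ℕ → ℝ} (h : ∀ y, Tendsto (fun i => f i y) l (𝓝 (g y))) (x : ℕ) :
    Tendsto (fun i => bellman S (α i) (f i) x) l (𝓝 (bellman S a g x)) :=
  ((hα.mul (tendsto_stepExp S true h x)).const_add _).min
    ((hα.mul (tendsto_stepExp S false h x)).const_add _)

/-- Value iteration produces a monotone solution of the optimality equation of linear growth. -/
theorem exists_bellman_fixed (hS : S.Valid) {α : ℝ} (hα0 : 0 < α) (hα1 : α < 1) :
    ∃ W : ℕ → ℝ, (∀ x, W x = bellman S α W x) ∧ Monotone W ∧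
      (∀ x, min 0 S.lam / (1 - α) ≤ W x) ∧
      ∀ x, W x ≤ S.C / (1 - α) * x + |S.lam| / (1 - α) := by
  have hα' : 0 < 1 - α := by linarith
  -- `L` is a subsolution because `min 0 λ` bounds every slot cost below. `U` is a supersolution
  -- because rejecting never increases the population.
  set L : ℝ := min 0 S.lam / (1 - α) with hL
  set U : ℕ → ℝ := fun x => S.C / (1 - α) * x + |S.lam| / (1 - α) with hU
  let W : ℕ → ℕ → ℝ := fun n => (bellman S α)^[n] fun _ => L
  have hsucc : ∀ n, W (n + 1) = bellman S α (W n) := fun n =>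
    Function.iterate_succ_apply' _ _ _
  have hLU : ∀ x, L ≤ U x := fun x => by
    have h1 : L ≤ |S.lam| / (1 - α) :=
      div_le_div_of_nonneg_right ((min_le_left _ _).trans (abs_nonneg _)) hα'.le
    have h2 : 0 ≤ S.C / (1 - α) * x := by have := hS.C_pos; positivity
    simp only [hU]; linarith
  have hTL : ∀ x, L ≤ bellman S α (fun _ => L) x := fun x => by
    refine le_bellman fun u => ?_
    rw [actionValue, stepExp_const]
    have h1 := min_zero_lam_le_cost hS x u
    have h2 : L * (1 - α) = min 0 S.lam := div_mul_cancel₀ _ hα'.ne'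
    linarith
  have hTU : ∀ x, bellman S α U x ≤ U x := fun x => by
    refine (bellman_le S α U false x).trans ?_
    rw [actionValue, cost_false]
    have h1 : stepExp S false U x ≤ U x := by
      simp only [hU]
      rw [stepExp_add, stepExp_const_mul, stepExp_const]
      have := mul_le_mul_of_nonneg_left (stepExp_false_cast_le hS x)
        (div_nonneg hS.C_pos.le hα'.le)
      linarith
    have h2 := mul_le_mul_of_nonneg_left h1 hα0.le
    have h3 : U x * (1 - α) = S.C * x + |S.lam| := by simp only [hU]; field_simp
    have h4 := le_abs_self S.lam
    linarith
  have hstep : ∀ n x, W n x ≤ W (n + 1) x := by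
    intro n
    induction n with
    | zero => exact hTL
    | succ n ih => intro x; rw [hsucc n, hsucc (n + 1)]; exact bellman_mono hS hα0.le ih x
  have hWU : ∀ n x, W n x ≤ U x := by
    intro n
    induction n with
    | zero => exact hLU
    | succ n ih =>
      intro x; rw [hsucc n]; exact (bellman_mono hS hα0.le ih x).trans (hTU x)
  have hmonx : ∀ n, Monotone (W n) := by
    intro n
    induction n with
    | zero => exact monotone_const
    | succ n ih => rw [hsucc n]; exact monotone_bellman hS hα0.le ih
  have hmon : ∀ x, Monotone fun n => W n x := fun x => monotone_nat_of_le_succ fun n => hstep n x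
  have hlim : ∀ x, Tendsto (fun n => W n x) atTop (𝓝 (⨆ n, W n x)) := fun x =>
    tendsto_atTop_ciSup (hmon x) ⟨U x, by rintro _ ⟨n, rfl⟩; exact hWU n x⟩
  refine ⟨fun x => ⨆ n, W n x, fun x => ?_, fun x y hxy => ?_, fun x => ?_, fun x => ?_⟩
  · refine tendsto_nhds_unique ((tendsto_add_atTop_iff_nat 1).2 (hlim x)) ?_
    simp only [hsucc]
    exact tendsto_bellman S tendsto_const_nhds hlim x
  · exact le_of_tendsto_of_tendsto' (hlim x) (hlim y) fun n => hmonx n hxy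
  · exact ge_of_tendsto' (hlim x) fun n => hmon x (Nat.zero_le n)
  · exact le_of_tendsto' (hlim x) fun n => hWU n x

end Bellman

/-! ### Discounted cost of a stationary policy -/

section Policies

theorem stateExp_mono (hS : S.Valid) (π : ℕ → Bool) (n : ℕ) {f g : ℕ → ℝ}
    (h : ∀ y, f y ≤ g y) (x : ℕ) : stateExp S π n f x ≤ stateExp S π n g x := by
  induction n generalizing x with
  | zero => exact h x
  | succ n ih => exact stepExp_mono hS _ _ ih

theorem stateExp_add (S : Station) (π : ℕ → Bool) (n : ℕ) (f g : ℕ → ℝ) (x : ℕ) :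
    stateExp S π n (fun y => f y + g y) x = stateExp S π n f x + stateExp S π n g x := by
  induction n generalizing x with
  | zero => rfl
  | succ n ih =>
    rw [stateExp, funext ih, stepExp_add]
    rfl

theorem stateExp_const_mul (S : Station) (π : ℕ → Bool) (n : ℕ) (c : ℝ) (f : ℕ → ℝ) (x : ℕ) :
    stateExp S π n (fun y => c * f y) x = c * stateExp S π n f x := by
  induction n generalizing x with
  | zero => rfl
  | succ n ih =>
    rw [stateExp, funext ih, stepExp_const_mul]
    rfl

theorem stateExp_const (S : Station) (π : ℕ → Bool) (n : ℕ) (c : ℝ) (x : ℕ) :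
    stateExp S π n (fun _ => c) x = c := by
  induction n generalizing x with
  | zero => rfl
  | succ n ih => rw [stateExp, funext ih, stepExp_const]

theorem stateExp_cast_le (hS : S.Valid) (π : ℕ → Bool) (n : ℕ) (x : ℕ) :
    stateExp S π n (fun y => (y : ℝ)) x ≤ x + n := by
  induction n generalizing x with
  | zero => simp [stateExp]
  | succ n ih =>
    have h1 := stepExp_mono hS (π x) x ih
    rw [stepExp_add, stepExp_const] at h1
    have h2 := stepExp_cast_le hS (π x) x
    rw [stateExp]
    push_cast
    linarith

/-- Functions of linear growth have expectations of linear growth in time. -/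
theorem abs_stateExp_le (hS : S.Valid) (π : ℕ → Bool) {f : ℕ → ℝ} {a b : ℝ} (ha : 0 ≤ a)
    (hf : ∀ y, |f y| ≤ a * y + b) (n x : ℕ) :
    |stateExp S π n f x| ≤ a * (x + n) + b := by
  have key : stateExp S π n (fun y : ℕ => a * y + b) x ≤ a * (x + n) + b := by
    rw [stateExp_add, stateExp_const_mul, stateExp_const]
    linarith [mul_le_mul_of_nonneg_left (stateExp_cast_le hS π n x) ha]
  rw [abs_le]
  constructor
  · have h := stateExp_mono hS π n (f := fun y => (-1) * (a * y + b)) (g := f)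
      (fun y => by linarith [neg_abs_le (f y), hf y]) x
    rw [stateExp_const_mul] at h
    linarith
  · exact (stateExp_mono hS π n (fun y => (le_abs_self _).trans (hf y)) x).trans key

theorem summable_pow_mul_linear {α : ℝ} (hα0 : 0 < α) (hα1 : α < 1) (a b : ℝ) :
    Summable fun n : ℕ => α ^ n * (a * n + b) := by
  have hn : ‖α‖ < 1 := by rwa [Real.norm_of_nonneg hα0.le]
  have h1 := (summable_pow_mul_geometric_of_norm_lt_one 1 hn).mul_left a
  have h2 := (summable_geometric_of_lt_one hα0.le hα1).mul_left b
  refine (h1.add h2).congr fun n => ?_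
  ring

theorem summable_pow_mul_stateExp (hS : S.Valid) {α : ℝ} (hα0 : 0 < α) (hα1 : α < 1)
    (π : ℕ → Bool) {f : ℕ → ℝ} {a b : ℝ} (ha : 0 ≤ a) (hf : ∀ y, |f y| ≤ a * y + b) (x : ℕ) :
    Summable fun n : ℕ => α ^ n * stateExp S π n f x := by
  refine Summable.of_norm_bounded (summable_pow_mul_linear hα0 hα1 a (a * x + b)) fun n => ?_
  rw [norm_mul, Real.norm_of_nonneg (pow_nonneg hα0.le n), Real.norm_eq_abs]
  refine mul_le_mul_of_nonneg_left ?_ (pow_nonneg hα0.le n)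
  linarith [abs_stateExp_le hS π ha hf n x]

/-- Expected discounted cost of the first `n` slots. -/
def partialCost (S : Station) (α : ℝ) (π : ℕ → Bool) (n x : ℕ) : ℝ :=
  ∑ k ∈ Finset.range n, α ^ k * stateExp S π k (fun y => cost S y (π y)) x

theorem partialCost_succ (S : Station) (α : ℝ) (π : ℕ → Bool) (n x : ℕ) :
    partialCost S α π (n + 1) x = actionValue S α (partialCost S α π n) (π x) x := by
  unfold actionValue partialCost
  rw [stepExp_sum, Finset.sum_range_succ', Finset.mul_sum, add_comm]
  congr 1
  · simp [stateExp]
  · refine Finset.sum_congr rfl fun k _ => ?_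
    rw [stepExp_const_mul, stateExp]
    ring

/-- Expected costs grow at most linearly in time, so the series converges and `tsum` is not its
default value. -/
theorem tendsto_partialCost (hS : S.Valid) {α : ℝ} (hα0 : 0 < α) (hα1 : α < 1)
    (π : ℕ → Bool) (x : ℕ) :
    Tendsto (fun n => partialCost S α π n x) atTop (𝓝 (discCost S α π x)) :=
  (summable_pow_mul_stateExp hS hα0 hα1 π hS.C_pos.le
    (fun y => abs_cost_le hS y (π y)) x).hasSum.tendsto_sum_nat

theorem discCost_eq (hS : S.Valid) {α : ℝ} (hα0 : 0 < α) (hα1 : α < 1) (π : ℕ → Bool) (x : ℕ) :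
    discCost S α π x = actionValue S α (discCost S α π) (π x) x := by
  refine tendsto_nhds_unique
    ((tendsto_add_atTop_iff_nat 1).2 (tendsto_partialCost hS hα0 hα1 π x)) ?_
  simp only [partialCost_succ]
  exact ((tendsto_stepExp S (π x) (tendsto_partialCost hS hα0 hα1 π) x).const_mul α).const_add _

theorem actionValue_add_mul (S : Station) (α : ℝ) (f g : ℕ → ℝ) (c : ℝ) (u : Bool) (x : ℕ) :
    actionValue S α (fun y => f y + c * g y) u x
      = actionValue S α f u x + α * c * stepExp S u g x := by
  simp only [actionValue, stepExp_add, stepExp_const_mul]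
  ring

theorem le_partialCost_add (hS : S.Valid) {α : ℝ} (hα0 : 0 ≤ α) {π : ℕ → Bool} {W : ℕ → ℝ}
    (hW : ∀ x, W x ≤ actionValue S α W (π x) x) (n x : ℕ) :
    W x ≤ partialCost S α π n x + α ^ n * stateExp S π n W x := by
  induction n generalizing x with
  | zero => simp [partialCost, stateExp]
  | succ n ih =>
    refine (hW x).trans ((actionValue_mono hS hα0 ih (π x) x).trans_eq ?_)
    rw [actionValue_add_mul, partialCost_succ, stateExp, pow_succ']

theorem eq_partialCost_add {α : ℝ} {π : ℕ → Bool} {W : ℕ → ℝ}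
    (hW : ∀ x, W x = actionValue S α W (π x) x) (n x : ℕ) :
    W x = partialCost S α π n x + α ^ n * stateExp S π n W x := by
  induction n generalizing x with
  | zero => simp [partialCost, stateExp]
  | succ n ih =>
    rw [partialCost_succ, stateExp, pow_succ', ← actionValue_add_mul]
    rw [hW x]
    congr 1
    exact funext ih

/-- Transversality: the terminal term vanishes for `W` of linear growth. -/
theorem tendsto_partialCost_add (hS : S.Valid) {α : ℝ} (hα0 : 0 < α) (hα1 : α < 1)
    (π : ℕ → Bool) {W : ℕ → ℝ} {a b : ℝ} (ha : 0 ≤ a) (hW : ∀ y, |W y| ≤ a * y + b) (x : ℕ) :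
    Tendsto (fun n => partialCost S α π n x + α ^ n * stateExp S π n W x) atTop
      (𝓝 (discCost S α π x)) := by
  simpa using (tendsto_partialCost hS hα0 hα1 π x).add
    (summable_pow_mul_stateExp hS hα0 hα1 π ha hW x).tendsto_atTop_zero

end Policies

/-! ### Discounted value function: verification, increments, bounds -/

section DiscountedValue

/-- The discounted value function is the monotone solution of the optimality equation, and every
policy that attains the minimum in that equation is optimal. -/
theorem discValue_spec (hS : S.Valid) {α : ℝ} (hα0 : 0 < α) (hα1 : α < 1) :
    (∀ x, discValue S α x = bellman S α (discValue S α) x) ∧ Monotone (discValue S α) ∧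
      (∀ x, min 0 S.lam / (1 - α) ≤ discValue S α x) ∧
      (∀ π x, discValue S α x ≤ discCost S α π x) ∧
      ∀ π : ℕ → Bool, (∀ x, discValue S α x = actionValue S α (discValue S α) (π x) x) →
        ∀ x, discCost S α π x = discValue S α x := by
  obtain ⟨W, hfix, hmono, hlow, hup⟩ := exists_bellman_fixed hS hα0 hα1
  have hα' : 0 < 1 - α := by linarith
  have ha : 0 ≤ S.C / (1 - α) := div_nonneg hS.C_pos.le hα'.le
  have habs : ∀ y, |W y| ≤ S.C / (1 - α) * y + |S.lam| / (1 - α) := fun y => by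
    refine abs_le.2 ⟨?_, hup y⟩
    have h1 : -(|S.lam| / (1 - α)) ≤ min 0 S.lam / (1 - α) := by
      rw [← neg_div]
      refine div_le_div_of_nonneg_right (le_min ?_ (neg_abs_le _)) hα'.le
      linarith [abs_nonneg S.lam]
    have h2 : 0 ≤ S.C / (1 - α) * y := mul_nonneg ha y.cast_nonneg
    linarith [hlow y]
  have hle : ∀ π x, W x ≤ discCost S α π x := fun π x =>
    ge_of_tendsto' (tendsto_partialCost_add hS hα0 hα1 π ha habs x) fun n =>
      le_partialCost_add hS hα0.le (fun y => (hfix y).trans_le (bellman_le S α W _ y)) n x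
  have hopt : ∀ π : ℕ → Bool, (∀ x, W x = actionValue S α W (π x) x) →
      ∀ x, discCost S α π x = W x := fun π hπ x => by
    refine tendsto_nhds_unique (tendsto_partialCost_add hS hα0 hα1 π ha habs x) ?_
    simp only [← eq_partialCost_add hπ]
    exact tendsto_const_nhds
  have hWV : discValue S α = W := by
    choose π hπ using exists_bellman_eq S α W
    funext x
    refine le_antisymm ?_ (le_ciInf fun π => hle π x)
    rw [← hopt π (fun y => (hfix y).trans (hπ y)) x]
    -- The lower bound `W x` makes the real infimum genuine.
    exact ciInf_le ⟨W x, by rintro _ ⟨π, rfl⟩; exact hle π x⟩ π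
  rw [hWV]
  exact ⟨hfix, hmono, hlow, hle, hopt⟩

/-- Every slot that the extra user must spend in the system adds `C` to the increment of the
discounted value. -/
theorem discValue_succ_ge (hS : S.Valid) {α : ℝ} (hα0 : 0 < α) (hα1 : α < 1) (k x : ℕ)
    (hx : k * S.M ≤ x) :
    discValue S α x + S.C * ∑ j ∈ Finset.range (k + 1), α ^ j ≤ discValue S α (x + 1) := by
  obtain ⟨hfix, hmono, -⟩ := discValue_spec hS hα0 hα1
  induction k generalizing x with
  | zero =>
    rw [hfix (x + 1)]
    -- The same action is used in both states, so the tax cancels.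
    refine le_bellman fun u => ?_
    have h1 := (hfix x).trans_le (bellman_le S α _ u x)
    have h2 := mul_le_mul_of_nonneg_left (monotone_stepExp hS u hmono x.le_succ) hα0.le
    refine (add_le_add_left h1 _).trans ?_
    simp only [actionValue, cost, Finset.range_one, Finset.sum_singleton, pow_zero, zero_add]
    push_cast
    linarith
  | succ k ih =>
    rw [hfix (x + 1)]
    refine le_bellman fun u => ?_
    have h1 := (hfix x).trans_le (bellman_le S α _ u x)
    -- At most `M` users depart, so from `x ≥ (k+1)M` the next state is at least `kM`, where the
    -- induction hypothesis applies.
    have hM : S.M ≤ x := le_trans (by nlinarith) hx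
    have h2 := mul_le_mul_of_nonneg_left (stepExp_succ_ge hS u hM
      fun y hy => ih y (by rw [add_mul] at hx; omega)) hα0.le
    refine (add_le_add_left h1 _).trans ?_
    rw [Finset.sum_range_succ', mul_add]
    simp only [pow_succ, ← Finset.sum_mul]
    simp only [actionValue, cost]
    push_cast
    linarith

theorem discValue_add_le_succ (hS : S.Valid) {α : ℝ} (hα0 : 0 < α) (hα1 : α < 1) (x : ℕ) :
    discValue S α x + S.C ≤ discValue S α (x + 1) := by
  simpa using discValue_succ_ge hS hα0 hα1 0 x (by simp)

theorem one_sub_mul_discValue_zero_mem (hS : S.Valid) {α : ℝ} (hα0 : 0 < α) (hα1 : α < 1) :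
    (1 - α) * discValue S α 0 ∈ Set.Icc (min 0 S.lam) S.lam := by
  obtain ⟨hfix, -, hlow, -⟩ := discValue_spec hS hα0 hα1
  have hα' : 0 < 1 - α := by linarith
  constructor
  · rw [mul_comm, ← div_le_iff₀ hα']
    exact hlow 0
  · have h := (hfix 0).trans_le (bellman_le S α _ false 0)
    have h0 : stepExp S false (discValue S α) 0 = discValue S α 0 := by
      rw [← stepExp_const S false (discValue S α 0) 0, stepExp_eq, stepExp_eq]
      simp
    rw [actionValue, cost_false, h0] at h
    push_cast at h
    linarith

/-- The discounted values relative to the empty station are bounded in the discount factor. -/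
theorem exists_discValue_sub_le (hS : S.Valid) (x : ℕ) :
    ∃ B : ℝ, ∀ α : ℝ, 0 < α → α < 1 → discValue S α x - discValue S α 0 ≤ B := by
  induction x with
  | zero => exact ⟨0, fun α _ _ => by simp⟩
  | succ x ih =>
    obtain ⟨B, hB⟩ := ih
    have hb : 0 < 1 - binomMix S 0 := by linarith [binomMix_zero_lt_one hS]
    -- Rejecting at `x + 1` leads to a state at most `x`, except with probability `b_0 < 1`; solving
    -- for the increment divides by `1 - b_0`.
    refine ⟨B + (S.C * (x + 1) + S.lam - min 0 S.lam) / (1 - binomMix S 0), fun α hα0 hα1 => ?_⟩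
    obtain ⟨hfix, hmono, -⟩ := discValue_spec hS hα0 hα1
    set V := discValue S α with hV
    have h1 := (hfix (x + 1)).trans_le (bellman_le S α _ false (x + 1))
    rw [actionValue, cost_false] at h1
    have h2 : stepExp S false (fun y => V y - V 0) (x + 1)
        ≤ binomMix S 0 * (V (x + 1) - V 0) + (1 - binomMix S 0) * (V x - V 0) := by
      have hs := sum_binomMix S
      rw [Finset.sum_range_succ'] at hs
      rw [stepExp_eq, Finset.sum_range_succ']
      have h3 : ∑ e ∈ Finset.range S.M, binomMix S (e + 1) *
          (S.p * (V (x + 1 - (e + 1) + Bool.toNat false) - V 0)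
            + (1 - S.p) * (V (x + 1 - (e + 1)) - V 0))
          ≤ ∑ e ∈ Finset.range S.M, binomMix S (e + 1) * (V x - V 0) := by
        refine Finset.sum_le_sum fun e _ =>
          mul_le_mul_of_nonneg_left ?_ (binomMix_nonneg hS _)
        have := hmono (show x + 1 - (e + 1) ≤ x by omega)
        simp only [Bool.toNat_false, add_zero]
        linarith
      rw [← Finset.sum_mul, show ∑ e ∈ Finset.range S.M, binomMix S (e + 1)
        = 1 - binomMix S 0 by linarith] at h3
      simp only [Bool.toNat_false, add_zero, Nat.sub_zero] at h3 ⊢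
      linarith
    have h4 : 0 ≤ stepExp S false (fun y => V y - V 0) (x + 1) := by
      rw [← stepExp_const S false 0 (x + 1)]
      exact stepExp_mono hS _ _ fun y => sub_nonneg.2 (hmono (Nat.zero_le y))
    have h5 := (one_sub_mul_discValue_zero_mem hS hα0 hα1).1
    have h6 := hB α hα0 hα1
    have h7 : α * stepExp S false (fun y => V y - V 0) (x + 1)
        ≤ stepExp S false (fun y => V y - V 0) (x + 1) := by
      nlinarith
    have h8 := stepExp_sub_const S false V (V 0) (x + 1)
    have h9 : (V (x + 1) - V x) * (1 - binomMix S 0) ≤ S.C * (x + 1) + S.lam - min 0 S.lam := by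
      rw [h8] at h7 h2
      push_cast at h1
      rw [← hV] at h5
      linarith
    have h10 := (le_div_iff₀ hb).2 h9
    linarith

end DiscountedValue

/-! ### One-sided behaviour of real meromorphic functions -/

section LeftLimits

/-- Unless it vanishes identically near `a`, `f` is continuous and zero-free on some interval left
of `a`, so it has constant sign there. -/
theorem _root_.MeromorphicAt.eventually_nonpos_left {f : ℝ → ℝ} {a : ℝ} (hf : MeromorphicAt f a)
    (hfreq : ∃ᶠ x in 𝓝[<] a, f x ≤ 0) : ∀ᶠ x in 𝓝[<] a, f x ≤ 0 := by
  have hle : 𝓝[<] a ≤ 𝓝[≠] a := nhdsWithin_mono _ fun x hx => ne_of_lt hx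
  rcases hf.eventually_eq_zero_or_eventually_ne_zero with h | h
  · filter_upwards [hle h] with x hx using hx.le
  · obtain ⟨l, hl, hsub⟩ := (mem_nhdsLT_iff_exists_Ioo_subset' (sub_one_lt a)).1
      (hle (h.and hf.eventually_continuousAt))
    have hmem : Set.Ioo l a ∈ 𝓝[<] a := Ioo_mem_nhdsLT hl
    obtain ⟨y, hy, hya⟩ := (hfreq.and_eventually hmem).exists
    filter_upwards [hmem] with x hx
    by_contra! hx0
    obtain ⟨z, hz, hz0⟩ := isPreconnected_Ioo.intermediate_value hya hx
      (fun w hw => (hsub hw).2.continuousWithinAt) ⟨hy, hx0.le⟩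
    exact (hsub hz).1 hz0

/-- Boundedness, even on one side, excludes a pole. -/
theorem _root_.MeromorphicAt.exists_tendsto_left_of_bounded {f : ℝ → ℝ} {a B : ℝ}
    (hf : MeromorphicAt f a) (hB : ∀ᶠ x in 𝓝[<] a, |f x| ≤ B) :
    ∃ c, Tendsto f (𝓝[<] a) (𝓝 c) := by
  have hle : 𝓝[<] a ≤ 𝓝[≠] a := nhdsWithin_mono _ fun x hx => ne_of_lt hx
  rcases lt_or_ge (meromorphicOrderAt f a) 0 with ho | ho
  · have h1 := tendsto_norm_cobounded_atTop.comp
      ((tendsto_cobounded_of_meromorphicOrderAt_neg ho).mono_left hle)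
    obtain ⟨x, hx, hx'⟩ := ((h1.eventually_gt_atTop B).and hB).exists
    exact absurd hx' (not_le.2 hx)
  · obtain ⟨c, hc⟩ := tendsto_nhds_of_meromorphicOrderAt_nonneg hf ho
    exact ⟨c, hc.mono_left hle⟩

theorem eventually_mem_Ioo_zero_one : ∀ᶠ α : ℝ in 𝓝[<] 1, 0 < α ∧ α < 1 :=
  Ioo_mem_nhdsLT zero_lt_one

end LeftLimits

/-! ### Reduction to finitely many policies -/

section Threshold

/-- For discount factors near one there are optimal policies that agree outside a fixed finite
set of states. -/
theorem exists_uniform_threshold (hS : S.Valid) : ∃ (N : ℕ) (v : Bool), (S.p = 0 ∨ v = false) ∧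
    ∀ᶠ α in 𝓝[<] (1 : ℝ), ∃ π : ℕ → Bool, (∀ x, N ≤ x → π x = v) ∧
      ∀ x, discCost S α π x = discValue S α x := by
  suffices h : ∃ (N : ℕ) (v : Bool), (S.p = 0 ∨ v = false) ∧
      ∀ᶠ α in 𝓝[<] (1 : ℝ), ∀ x, N ≤ x → ∀ u,
        actionValue S α (discValue S α) v x ≤ actionValue S α (discValue S α) u x by
    obtain ⟨N, v, hv, h⟩ := h
    refine ⟨N, v, hv, ?_⟩
    filter_upwards [h, eventually_mem_Ioo_zero_one] with α hα hα01
    obtain ⟨hfix, -, -, -, hopt⟩ := discValue_spec hS hα01.1 hα01.2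
    choose π hπ using exists_bellman_eq S α (discValue S α)
    refine ⟨fun x => if N ≤ x then v else π x, fun x hx => if_pos hx, hopt _ fun x => ?_⟩
    by_cases hx : N ≤ x
    · rw [if_pos hx]
      exact ((hfix x).trans_le (bellman_le S α _ v x)).antisymm
        ((le_bellman (hα x hx)).trans_eq (hfix x).symm)
    · rw [if_neg hx]
      exact (hfix x).trans (hπ x)
  rcases hS.p_nonneg.eq_or_lt with hp | hp
  · refine ⟨0, decide (0 ≤ S.lam), Or.inl hp.symm, Eventually.of_forall fun α x _ u => ?_⟩
    rw [actionValue, actionValue, stepExp_of_p_eq_zero hp.symm u (decide (0 ≤ S.lam))]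
    refine add_le_add_left ?_ _
    by_cases hl : 0 ≤ S.lam
    · rw [decide_eq_true hl]
      cases u <;> simp only [cost_true, cost_false] <;> linarith
    · rw [decide_eq_false hl]
      cases u <;> simp only [cost_true, cost_false] <;> linarith
  -- At α = 1 accepting costs at least `p C (k + 1)` extra beyond the threshold. This `k` makes that
  -- exceed λ, and continuity extends it to α near 1.
  · obtain ⟨k, hk⟩ := exists_nat_gt (S.lam / (S.p * S.C))
    refine ⟨(k + 1) * S.M, false, Or.inr rfl, ?_⟩
    have hlim : Tendsto (fun α : ℝ => α * (S.p * (S.C * ∑ j ∈ Finset.range (k + 1), α ^ j)))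
        (𝓝[<] 1) (𝓝 (1 * (S.p * (S.C * ∑ j ∈ Finset.range (k + 1), (1 : ℝ) ^ j)))) := by
      refine Tendsto.mono_left (Continuous.tendsto ?_ 1) nhdsWithin_le_nhds
      fun_prop
    have hlt : S.lam < 1 * (S.p * (S.C * ∑ j ∈ Finset.range (k + 1), (1 : ℝ) ^ j)) := by
      have hpC : 0 < S.p * S.C := mul_pos hp hS.C_pos
      rw [div_lt_iff₀ hpC] at hk
      simp only [one_pow, Finset.sum_const, Finset.card_range, nsmul_eq_mul, mul_one, one_mul]
      push_cast
      linarith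
    filter_upwards [hlim.eventually_const_lt hlt, eventually_mem_Ioo_zero_one] with α hα hα01 x hx u
    have h1 := stepExp_true_ge (x := x) hS fun y hy => discValue_succ_ge hS hα01.1 hα01.2 k y
      (by rw [add_mul] at hx; omega)
    have h2 := mul_le_mul_of_nonneg_left h1 hα01.1.le
    cases u
    · exact le_rfl
    · rw [actionValue, actionValue, cost_true, cost_false]
      linarith

end Threshold

/-! ### Rationality in the discount factor and a policy optimal near one -/

section Rational

/-- The states up to `K` can be left only through an accepted arrival at `K`, which `hu` excludes.
-/
theorem stepExp_congr {K x : ℕ} {u : Bool} (hx : x ≤ K) (hu : S.p = 0 ∨ u = false ∨ x < K)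
    {f g : ℕ → ℝ} (h : ∀ y, y ≤ K → f y = g y) : stepExp S u f x = stepExp S u g x := by
  rw [stepExp_eq, stepExp_eq]
  refine Finset.sum_congr rfl fun e _ => ?_
  rw [h (x - e) (by omega)]
  rcases hu with hp | rfl | hxK
  · simp [hp]
  · rw [Bool.toNat_false, add_zero, h (x - e) (by omega)]
  · have := Bool.toNat_le u
    rw [h (x - e + u.toNat) (by omega)]

/-- Cramer's rule: on a finite closed set of states the discounted cost of a policy is a rational
function of the discount factor. -/
theorem exists_polynomial_discCost (hS : S.Valid) {π : ℕ → Bool} {K : ℕ}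
    (hπ : ∀ x, x ≤ K → S.p = 0 ∨ π x = false ∨ x < K) {x : ℕ} (hx : x ≤ K) :
    ∃ a b : Polynomial ℝ, b ≠ 0 ∧
      ∀ α : ℝ, 0 < α → α < 1 → b.eval α * discCost S α π x = a.eval α := by
  let P : Matrix (Fin (K + 1)) (Fin (K + 1)) ℝ :=
    fun i j => stepExp S (π i) (fun y => if y = j then 1 else 0) i
  have hP : ∀ (f : ℕ → ℝ) (i : Fin (K + 1)),
      stepExp S (π i) f i = P.mulVec (fun j => f j) i := fun f i => by
    have hi : (i : ℕ) ≤ K := Nat.lt_succ_iff.1 i.2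
    rw [stepExp_congr hi (hπ i hi) (g := fun y => ∑ j : Fin (K + 1), f j * if y = j then 1 else 0)
      fun y hy => ?_]
    · rw [stepExp_sum]
      simp only [stepExp_const_mul, Matrix.mulVec, dotProduct, P, mul_comm]
    · rw [Finset.sum_eq_single (⟨y, Nat.lt_succ_iff.2 hy⟩ : Fin (K + 1))]
      · simp
      · intro j _ hj
        rw [if_neg fun h => hj (Fin.ext h.symm), mul_zero]
      · simp
  let A : Matrix (Fin (K + 1)) (Fin (K + 1)) (Polynomial ℝ) :=
    1 - (Polynomial.X : Polynomial ℝ) • P.map Polynomial.C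
  have hA : ∀ α : ℝ, (Polynomial.evalRingHom α).mapMatrix A = 1 - α • P := fun α => by
    ext i j
    by_cases hij : i = j
    · simp [A, hij, mul_comm α]
    · simp [A, hij, mul_comm α]
  let c : Fin (K + 1) → ℝ := fun i => cost S i (π i)
  refine ⟨(A.adjugate.mulVec fun j => Polynomial.C (c j)) ⟨x, Nat.lt_succ_iff.2 hx⟩, A.det,
    fun h0 => ?_, fun α hα0 hα1 => ?_⟩
  -- At α = 0 the matrix is the identity, so its determinant is not the zero polynomial.
  · have h1 := (Polynomial.evalRingHom (0 : ℝ)).map_det A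
    rw [hA, h0] at h1
    simp at h1
  · let J : Fin (K + 1) → ℝ := fun i => discCost S α π i
    have hJ : (1 - α • P).mulVec J = c := by
      funext i
      rw [Matrix.sub_mulVec, Matrix.one_mulVec, Matrix.smul_mulVec, Pi.sub_apply, Pi.smul_apply,
        ← hP (discCost S α π) i, sub_eq_iff_eq_add]
      exact discCost_eq hS hα0 hα1 π i
    have h1 := congrArg (fun v => (1 - α • P).adjugate.mulVec v) hJ
    simp only [Matrix.mulVec_mulVec, Matrix.adjugate_mul, Matrix.smul_mulVec,
      Matrix.one_mulVec] at h1
    rw [← hA, ← RingHom.map_adjugate, ← RingHom.map_det] at h1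
    have h2 := congrFun h1 ⟨x, Nat.lt_succ_iff.2 hx⟩
    rw [Pi.smul_apply, smul_eq_mul] at h2
    refine h2.trans ?_
    simp [Matrix.mulVec, dotProduct, Polynomial.eval_finsetSum]

theorem exists_meromorphicAt_discCost (hS : S.Valid) {π : ℕ → Bool} {N : ℕ} {v : Bool}
    (hv : S.p = 0 ∨ v = false) (hπ : ∀ x, N ≤ x → π x = v) (x : ℕ) :
    ∃ F : ℝ → ℝ, MeromorphicAt F 1 ∧ (fun α => discCost S α π x) =ᶠ[𝓝[<] 1] F := by
  obtain ⟨a, b, hb, hab⟩ := exists_polynomial_discCost hS (π := π) (K := max N x)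
    (fun y hy => by
      rcases hv with hp | hv
      · exact Or.inl hp
      · rcases lt_or_ge y (max N x) with h | h
        · exact Or.inr (Or.inr h)
        · exact Or.inr (Or.inl ((hπ y ((le_max_left _ _).trans h)).trans hv)))
    (le_max_right N x)
  refine ⟨fun α => a.eval α / b.eval α, ?_, ?_⟩
  · exact (AnalyticOnNhd.eval_polynomial a 1 (Set.mem_univ _)).meromorphicAt.div
      (AnalyticOnNhd.eval_polynomial b 1 (Set.mem_univ _)).meromorphicAt
  · have hfin : {α : ℝ | b.eval α = 0}.Finite := by
      simpa [Polynomial.IsRoot] using Polynomial.finite_setOfPred_isRoot hb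
    have hne : ∀ᶠ α in 𝓝[<] (1 : ℝ), b.eval α ≠ 0 := by
      -- The point 1 may itself be a root and is removed; only α < 1 matters.
      have h1 : ({α : ℝ | b.eval α = 0} \ {1})ᶜ ∈ 𝓝 (1 : ℝ) :=
        (hfin.subset Set.sdiff_subset).isClosed.compl_mem_nhds (by simp)
      filter_upwards [nhdsWithin_le_nhds h1, self_mem_nhdsWithin] with α hα hα1 h0
      exact hα ⟨h0, ne_of_lt hα1⟩
    filter_upwards [hne, eventually_mem_Ioo_zero_one] with α hα hα01
    rw [eq_div_iff hα, mul_comm]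
    exact hab α hα01.1 hα01.2

theorem finite_setOf_eventually_const (N : ℕ) (v : Bool) :
    {π : ℕ → Bool | ∀ x, N ≤ x → π x = v}.Finite := by
  refine Set.Finite.of_injOn (f := fun π (i : Fin N) => π i) (t := Set.univ)
    (fun _ _ => Set.mem_univ _) (fun π hπ π' hπ' h => ?_) Set.finite_univ
  funext x
  rcases lt_or_ge x N with hx | hx
  · exact congrFun h ⟨x, hx⟩
  · rw [hπ x hx, hπ' x hx]

/-- Near discount factor one, the discounted value is a meromorphic function of the discount
factor, because one policy is optimal throughout. -/
theorem exists_meromorphicAt_discValue (hS : S.Valid) (x : ℕ) :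
    ∃ F : ℝ → ℝ, MeromorphicAt F 1 ∧ (fun α => discValue S α x) =ᶠ[𝓝[<] 1] F := by
  obtain ⟨N, v, hv, hopt⟩ := exists_uniform_threshold hS
  have hfin := finite_setOf_eventually_const N v
  obtain ⟨π, hπ, hfreq⟩ : ∃ π : ℕ → Bool, (∀ y, N ≤ y → π y = v) ∧
      ∃ᶠ α in 𝓝[<] (1 : ℝ), discCost S α π x = discValue S α x := by
    -- Pigeonhole: among finitely many candidates, one is optimal at `x` for α arbitrarily close to
    -- 1.
    by_contra! hcon
    have hall := (eventually_all_finite hfin).2 hcon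
    obtain ⟨α, hα, π, hπ, hπα⟩ := (hall.and hopt).exists
    exact hα π hπ (hπα x)
  obtain ⟨F, hF, hFπ⟩ := exists_meromorphicAt_discCost hS hv hπ x
  refine ⟨F, hF, ?_⟩
  have hle : ∀ π' ∈ {π : ℕ → Bool | ∀ y, N ≤ y → π y = v},
      ∀ᶠ α in 𝓝[<] (1 : ℝ), discCost S α π x ≤ discCost S α π' x := fun π' hπ' => by
    obtain ⟨G, hG, hGπ⟩ := exists_meromorphicAt_discCost hS hv hπ' x
    -- Optimality along a sequence of α gives the sign frequently; meromorphy makes it hold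
    -- eventually.
    have hdiff : ∃ᶠ α in 𝓝[<] (1 : ℝ), (F - G) α ≤ 0 := by
      refine ((hfreq.and_eventually (hFπ.and hGπ)).and_eventually
        eventually_mem_Ioo_zero_one).mono ?_
      rintro α ⟨⟨h1, h2, h3⟩, hα⟩
      obtain ⟨-, -, -, hlow, -⟩ := discValue_spec hS hα.1 hα.2
      have := hlow π' x
      rw [Pi.sub_apply, ← h2, ← h3]
      linarith
    filter_upwards [(hF.sub hG).eventually_nonpos_left hdiff, hFπ, hGπ]
      with α h1 h2 h3
    rw [Pi.sub_apply, ← h2, ← h3] at h1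
    linarith
  filter_upwards [(eventually_all_finite hfin).2 hle, hopt, hFπ, eventually_mem_Ioo_zero_one]
    with α h1 ⟨π', hπ', h2⟩ h3 hα
  obtain ⟨-, -, -, hlow, -⟩ := discValue_spec hS hα.1 hα.2
  rw [← h3]
  exact le_antisymm (hlow π x) ((h1 π' hπ').trans_eq (h2 x))

end Rational

/-! ### Vanishing-discount limit -/

section VanishingDiscount

theorem exists_tendsto_discValue_sub (hS : S.Valid) (x : ℕ) :
    ∃ c, Tendsto (fun α : ℝ => discValue S α x - discValue S α 0) (𝓝[<] 1) (𝓝 c) := by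
  obtain ⟨F, hF, hFx⟩ := exists_meromorphicAt_discValue hS x
  obtain ⟨G, hG, hG0⟩ := exists_meromorphicAt_discValue hS 0
  obtain ⟨B, hB⟩ := exists_discValue_sub_le hS x
  have heq : (fun α => discValue S α x - discValue S α 0) =ᶠ[𝓝[<] 1] F - G := hFx.sub hG0
  obtain ⟨c, hc⟩ := (hF.sub hG).exists_tendsto_left_of_bounded (B := B) (by
    filter_upwards [heq, eventually_mem_Ioo_zero_one] with α h1 hα
    obtain ⟨-, hmono, -⟩ := discValue_spec hS hα.1 hα.2
    rw [← h1, abs_of_nonneg (sub_nonneg.2 (hmono (Nat.zero_le x)))]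
    exact hB α hα.1 hα.2)
  exact ⟨c, hc.congr' heq.symm⟩

theorem exists_tendsto_one_sub_mul_discValue (hS : S.Valid) :
    ∃ c, Tendsto (fun α : ℝ => (1 - α) * discValue S α 0) (𝓝[<] 1) (𝓝 c) := by
  obtain ⟨G, hG, hG0⟩ := exists_meromorphicAt_discValue hS 0
  have h1 : MeromorphicAt (fun α : ℝ => 1 - α) 1 := by fun_prop
  have heq : (fun α => (1 - α) * discValue S α 0) =ᶠ[𝓝[<] 1] (fun α : ℝ => 1 - α) * G := by
    filter_upwards [hG0] with α hα
    rw [Pi.mul_apply, ← hα]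
  obtain ⟨c, hc⟩ := (h1.mul hG).exists_tendsto_left_of_bounded (B := |S.lam|) (by
    filter_upwards [heq, eventually_mem_Ioo_zero_one] with α h2 hα
    obtain ⟨h3, h4⟩ := one_sub_mul_discValue_zero_mem hS hα.1 hα.2
    rw [← h2, abs_le]
    refine ⟨le_trans (le_min ?_ (neg_abs_le _)) h3, h4.trans (le_abs_self _)⟩
    linarith [abs_nonneg S.lam])
  exact ⟨c, hc.congr' heq.symm⟩

/-- In the tail, either `e = M` or both truncated differences are 0, which matches the form of the
dynamic programming equation. -/
theorem sum_binomMix_mul_eq (S : Station) (x : ℕ) (g : ℕ → ℝ) :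
    ∑ e ∈ Finset.range (S.M + 1), binomMix S e * g (x - e)
      = ∑ d ∈ Finset.range (min S.M x), g (x - d) * binomMix S d
        + g (x - S.M) * ∑ d ∈ Finset.Icc (min S.M x) S.M, binomMix S d := by
  rw [← Finset.sum_range_add_sum_Ico (fun e => binomMix S e * g (x - e))
    (show min S.M x ≤ S.M + 1 by omega)]
  congr 1
  · exact Finset.sum_congr rfl fun d _ => mul_comm _ _
  · rw [Finset.mul_sum]
    refine Finset.sum_congr ?_ fun e he => ?_
    · ext e; simp only [Finset.mem_Icc, Finset.mem_Ico]; omega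
    · have := Finset.mem_Icc.1 he
      rw [show x - e = x - S.M by omega, mul_comm]

theorem solvesDPE_of_eq_bellman {V : ℕ → ℝ} {η : ℝ}
    (h : ∀ x, V x = bellman S 1 V x - η) : SolvesDPE S V η := by
  intro x
  have hsplit : ∀ u : Bool, stepExp S u V x
      = S.p * ∑ e ∈ Finset.range (S.M + 1), binomMix S e * V (x - e + u.toNat)
        + (1 - S.p) * ∑ e ∈ Finset.range (S.M + 1), binomMix S e * V (x - e) := fun u => by
    rw [stepExp_eq, Finset.mul_sum, Finset.mul_sum, ← Finset.sum_add_distrib]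
    exact Finset.sum_congr rfl fun e _ => by ring
  have hV := sum_binomMix_mul_eq S x V
  have h1 := hsplit true
  have h2 := hsplit false
  simp only [Bool.toNat_true, Bool.toNat_false, add_zero] at h1 h2
  rw [sum_binomMix_mul_eq S x fun y => V (y + 1), hV] at h1
  rw [hV, ← add_mul, add_sub_cancel, one_mul] at h2
  rw [h x, bellman, actionValue, actionValue, cost_true, cost_false, one_mul, one_mul, h1, h2,
    add_assoc (S.C * (x : ℝ)), min_add_add_left, add_sub_right_comm]
  simp only [mul_left_comm _ S.p, mul_left_comm _ (1 - S.p), ← Finset.mul_sum]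
  congr 2 <;> ring

theorem exists_isRelativeValueFunction (hS : S.Valid) :
    ∃ (V : ℕ → ℝ) (η : ℝ), IsRelativeValueFunction S V η := by
  choose V hV using exists_tendsto_discValue_sub hS
  obtain ⟨η, hη⟩ := exists_tendsto_one_sub_mul_discValue hS
  refine ⟨V, η, solvesDPE_of_eq_bellman fun x => ?_, ?_, hV, hη⟩
  · have hid : Tendsto (fun α : ℝ => α) (𝓝[<] 1) (𝓝 1) := nhdsWithin_le_nhds
    refine tendsto_nhds_unique (hV x) (((tendsto_bellman S hid hV x).sub hη).congr' ?_)
    filter_upwards [eventually_mem_Ioo_zero_one] with α hα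
    obtain ⟨hfix, -⟩ := discValue_spec hS hα.1 hα.2
    -- Centring at state 0 shifts by α V^α(0) inside and V^α(0) outside; the difference (1-α)V^α(0)
    -- tends to η.
    have hshift : ∀ u, actionValue S α (fun y => discValue S α y - discValue S α 0) u x
        = actionValue S α (discValue S α) u x - α * discValue S α 0 := fun u => by
      rw [actionValue, stepExp_sub_const, actionValue]
      ring
    rw [bellman, hshift, hshift, min_sub_sub_right, hfix x, bellman]
    ring
  · exact tendsto_nhds_unique (hV 0) (by simp)

theorem IsRelativeValueFunction.add_le_succ (hS : S.Valid) {V : ℕ → ℝ} {η : ℝ}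
    (h : IsRelativeValueFunction S V η) (x : ℕ) : V x + S.C ≤ V (x + 1) := by
  refine le_of_tendsto_of_tendsto ((h.tendsto_value x).add_const S.C) (h.tendsto_value (x + 1)) ?_
  filter_upwards [eventually_mem_Ioo_zero_one] with α hα
  linarith [discValue_add_le_succ hS hα.1 hα.2 x]

end VanishingDiscount

end AssocMDP

theorem lemma2 (S : AssocMDP.Station)
    (hM : 1 ≤ S.M)
    (hp0 : 0 ≤ S.p) (hp1 : S.p ≤ 1)
    (hq0 : 0 < S.q) (hq1 : S.q < 1)
    (hr0 : 0 ≤ S.rJam) (hrr : S.rJam < S.rClear) (hr1 : S.rClear ≤ 1)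
    (hC : 0 < S.C) :
    (∃ (V : ℕ → ℝ) (η : ℝ), AssocMDP.IsRelativeValueFunction S V η) ∧
      ∀ (V : ℕ → ℝ) (η : ℝ), AssocMDP.IsRelativeValueFunction S V η → StrictMono V := by
  have hS : S.Valid := ⟨hp0, hp1, hq0, hq1, hr0, hrr, hr1, hC, hM⟩
  refine ⟨AssocMDP.exists_isRelativeValueFunction hS, fun V η h => strictMono_nat_of_lt_succ
    fun x => ?_⟩
  linarith [h.add_le_succ hS x]
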